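/- For positive integers $n$ and complex numbers $s_1,\dots,s_n$ write $$\zeta^{\star}(s_1,\dots,s_n)=\sum_{1\le m_1\le m_2\le\cdots\le m_n}\frac{1}{m_1^{s_1}m_2^{s_2}\cdots m_n^{s_n}}.$$ Let $\mathbb N'=\{1'<1<2'<2<\cdots\}$ and $|i|=|i'|=i$. For a strict partition $\lambda=(\lambda_1>\lambda_2>\cdots)$ with shifted diagram $SD(\lambda)=\{(i,j): i\le j\le \lambda_i+i-1\}$, let $QSST(\lambda)$ be the set of fillings $M=(m_{ij})$ of $SD(\lambda)$ with letters of $\mathbb N'$ that are weakly increasing along each row and each column, with each marked letter $i'$ occurring at most once in every row and each unmarked letter $i$ at most once in every column. For complex numbers $\boldsymbol s=(s_{ij})_{(i,j)\in SD(\lambda)}$ put $$\zeta^{Q}_{\lambda}(\boldsymbol s)=\sum_{M\in QSST(\lambda)}\ \prod_{(i,j)\in SD(\lambda)}\frac{1}{|m_{ij}|^{s_{ij}}}.$$ Theorem. Let $r\ge 1$ and let $k_1,\dots,k_r$ be positive odd integers with $k_r\ge 3$. Put $\mu_{2k+1}=(1,\{2\}^{k})$ for $k\ge 0$, where $\{2\}^{k}$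 means that $2$ is repeated $k$ times. Then for the one-row shape $\lambda=(r)$ with entries $k_1,\dots,k_r$ from left to right, $$\zeta^{Q}_{(r)}(k_1,\dots,k_r)=\zeta^{\star}(\mu_{k_1},\dots,\mu_{k_r})=\zeta^{\star}\bigl(1,\{2\}^{\frac{k_1-1}{2}},\dots,1,\{2\}^{\frac{k_r-1}{2}}\bigr),$$ where both the series on the left and the zeta-star series converge absolutely. -/

import Mathlib

/-- A strict partition: a finite strictly decreasing sequence of nonnegative integers. -/
structure StrictPartition where
  rows : ℕ
  part : Fin rows → ℕ
  strict : StrictAnti part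

namespace StrictPartition

/-- The boxes of the shifted diagram: row `i` holds `part i` boxes. The box `⟨i, j⟩`
(both counted from zero) sits at the matrix position `(row, col) = (i + 1, i + 1 + j)`. -/
abbrev Box (lam : StrictPartition) : Type := (i : Fin lam.rows) × Fin (lam.part i)

/-- The row of a box, counted from one. -/
def Box.row {lam : StrictPartition} (b : lam.Box) : ℕ := b.1 + 1

/-- The column of a box, counted from one; the `i`-th row starts in column `i`. -/
def Box.col {lam : StrictPartition} (b : lam.Box) : ℕ := b.1 + 1 + b.2

end StrictPartition

/-- A shifted tableau of shape `lam` over `X`: a filling of the shifted diagram. -/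
abbrev ShiftedTableau (lam : StrictPartition) (X : Type*) : Type _ := lam.Box → X

/-- The alphabet `1' < 1 < 2' < 2 < ⋯`: pairs `(i, b)` in lexicographic order, where
`b = false` is the marked letter `i'` and `b = true` the unmarked letter `i`. -/
abbrev MarkedLetter : Type := ℕ+ ×ₗ Bool

namespace MarkedLetter

/-- The letter `i'`. -/
def marked (i : ℕ+) : MarkedLetter := toLex (i, false)

/-- The letter `i`. -/
def unmarked (i : ℕ+) : MarkedLetter := toLex (i, true)

/-- `|i| = |i'| = i`. -/
def abs (x : MarkedLetter) : ℕ+ := (ofLex x).1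

end MarkedLetter

/-- Semi-standard marked shifted tableaux, with no condition on the main diagonal. -/
structure IsQSST {lam : StrictPartition} (t : ShiftedTableau lam MarkedLetter) : Prop where
  row_weak : ∀ b c : lam.Box, b.row = c.row → b.col ≤ c.col → t b ≤ t c
  col_weak : ∀ b c : lam.Box, b.col = c.col → b.row ≤ c.row → t b ≤ t c
  marked_row : ∀ (i : ℕ+) (b c : lam.Box), b.row = c.row →
    t b = MarkedLetter.marked i → t c = MarkedLetter.marked i → b = c
  unmarked_col : ∀ (i : ℕ+) (b c : lam.Box), b.col = c.col →
    t b = MarkedLetter.unmarked i → t c = MarkedLetter.unmarked i → b = c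

/-- The set `QSST(lam)`. -/
abbrev QSST (lam : StrictPartition) : Type :=
  {t : ShiftedTableau lam MarkedLetter // IsQSST t}

/-- The term `1 / M ^ s`, with `M ^ s = ∏ |m_ij| ^ s_ij`. -/
noncomputable def schurQTerm {lam : StrictPartition} (s : ShiftedTableau lam ℂ)
    (M : QSST lam) : ℂ :=
  1 / ∏ b : lam.Box, ((MarkedLetter.abs (M.1 b) : ℕ) : ℂ) ^ s b

/-- The Schur Q-multiple zeta function of shape `lam`. -/
noncomputable def schurQZeta (lam : StrictPartition) (s : ShiftedTableau lam ℂ) : ℂ :=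
  ∑' M : QSST lam, schurQTerm s M

/-- The one-row partition `(r)`. -/
def oneRow (r : ℕ) : StrictPartition where
  rows := 1
  part := fun _ => r
  strict := fun i j h => absurd h (by simp [Subsingleton.elim i j])

/-- The one-row tableau with entries `x 0, x 1, …` from left to right. -/
def oneRowTableau {X : Type*} {r : ℕ} (x : Fin r → X) : ShiftedTableau (oneRow r) X :=
  fun b => x b.2

/-- The summation range `1 ≤ m_1 ≤ ⋯ ≤ m_n` of a multiple zeta-star series. -/
abbrev WeakTuple (n : ℕ) : Type := {m : Fin n → ℕ+ // Monotone m}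

/-- The term `1 / (m_1 ^ s_1 ⋯ m_n ^ s_n)`. -/
noncomputable def zetaStarTerm (s : List ℂ) (m : WeakTuple s.length) : ℂ :=
  1 / ∏ i : Fin s.length, ((m.1 i : ℕ) : ℂ) ^ s.get i

/-- The multiple zeta-star function, the sum over `1 ≤ m_1 ≤ ⋯ ≤ m_n`. -/
noncomputable def zetaStar (s : List ℂ) : ℂ :=
  ∑' m : WeakTuple s.length, zetaStarTerm s m

/-- For odd `k`, the index `(1, 2, …, 2)` with `(k - 1) / 2` twos. -/
def muIndex (k : ℕ) : List ℂ := 1 :: List.replicate ((k - 1) / 2) 2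

/-- The concatenated index `(mu_{k_1}, …, mu_{k_r})`. -/
def muConcat {r : ℕ} (k : Fin r → ℕ) : List ℂ :=
  (List.ofFn fun i => muIndex (k i)).flatten

/-! Let B(N,k) = C(N,k)/C(N+k,k) = N!²/((N-k)!(N+k)!) for k ≤ N. Truncated star sums are expanded as
F(N) = ∑_k B(N,k) a(k), starting from F = 1 and a = δ_0. Since B(N,k) - B(N-1,k) = B(N,k) k²/N²,
appending the exponent 2 to F divides a(m) by m² when a(0) = 0 (`IsBinomTransform.starStep_two`).
Abel summation shows that appending 1 replaces a(m) by (a(m) + 2∑_{j<m} a(j))/m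
(`IsBinomTransform.starStep_one`). So a block 1,{2}^q acts with the single weight m^{-(2q+1)}.

Marked rows obey the same recursion: m' may follow only letters of absolute value < m, while m may
follow those of absolute value ≤ m. Together they contribute ∑_{j<m} a(j) + ∑_{j≤m} a(j)
(`rowWeight_mul_add`).

As k_r ≥ 3, the star index ends in 2, and ∑_m B(m,k)/m² = 1/k² removes the truncation
(`IsBinomTransform.tsum_powWeight_two_mul`). The comparison takes place in [0,∞], so finiteness on
the marked side alone gives both convergences. -/

open Finset Filter Topology

/-! ### The finite transformation -/

/-- The ratio `binom n k / binom (n + k) k`. -/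
noncomputable def binomRatio (n : ℕ) : ℕ → ℝ
  | 0 => 1
  | k + 1 => binomRatio n k * (((n : ℝ) - k) / (n + k + 1))

theorem binomRatio_succ_mul (n k : ℕ) :
    binomRatio n (k + 1) * (n + k + 1) = binomRatio n k * (n - k) := by
  have : (n : ℝ) + k + 1 ≠ 0 := by positivity
  rw [binomRatio]; field_simp

theorem binomRatio_eq_zero_of_lt {n k : ℕ} (h : n < k) : binomRatio n k = 0 := by
  induction k with
  | zero => omega
  | succ k ih =>
    rw [binomRatio]
    rcases Nat.lt_succ_iff_lt_or_eq.1 h with h | rfl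
    · rw [ih h, zero_mul]
    · simp

theorem binomRatio_nonneg (n k : ℕ) : 0 ≤ binomRatio n k := by
  induction k with
  | zero => simp [binomRatio]
  | succ k ih =>
    rcases le_or_gt k n with h | h
    · have : (0 : ℝ) ≤ n - k := sub_nonneg.2 (by exact_mod_cast h)
      rw [binomRatio]; positivity
    · rw [binomRatio_eq_zero_of_lt (by omega)]

/-- Read off from n!²/((n-k)!(n+k)!). Cleared of denominators, it also covers k = n + 1, where both
sides vanish. -/
theorem binomRatio_pred_mul_sq (n k : ℕ) :
    binomRatio n k * ((n : ℝ) + 1) ^ 2 =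
      binomRatio (n + 1) k * (((n : ℝ) + 1) ^ 2 - (k : ℝ) ^ 2) := by
  induction k with
  | zero => simp [binomRatio]
  | succ k ih =>
    have h1 : (n : ℝ) + k + 1 ≠ 0 := by positivity
    have h2 := binomRatio_succ_mul n k
    have h3 := binomRatio_succ_mul (n + 1) k
    push_cast at h3 ⊢
    apply mul_right_cancel₀ h1
    linear_combination ((n : ℝ) + 1) ^ 2 * h2 + ((n : ℝ) - k) * ih
      - (n - k) * (n + k + 1) * h3

theorem binomRatio_sub_pred (n k : ℕ) :
    binomRatio (n + 1) k - binomRatio n k =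
      binomRatio (n + 1) k * ((k : ℝ) ^ 2 / ((n : ℝ) + 1) ^ 2) := by
  have h : ((n : ℝ) + 1) ≠ 0 := by positivity
  have := binomRatio_pred_mul_sq n k
  field_simp
  linear_combination -this

theorem tendsto_binomRatio (k : ℕ) : Tendsto (fun n => binomRatio n k) atTop (𝓝 1) := by
  induction k with
  | zero => simp [binomRatio]
  | succ k ih =>
    have h : Tendsto (fun n : ℕ => ((n : ℝ) - k) / (n + k + 1)) atTop (𝓝 1) := by
      have h0 : Tendsto (fun n : ℕ => (2 * (k : ℝ) + 1) / ((n : ℝ) + (k + 1))) atTop (𝓝 0) :=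
        tendsto_const_nhds.div_atTop
          (tendsto_atTop_add_const_right _ _ tendsto_natCast_atTop_atTop)
      have := h0.const_sub 1
      rw [sub_zero] at this
      refine this.congr fun n => ?_
      have : (n : ℝ) + k + 1 ≠ 0 := by positivity
      field_simp; ring
    simpa [binomRatio] using ih.mul h

/-- `F N` is the `binomRatio N`-weighted sum of `a` for every `N`. -/
def IsBinomTransform (F a : ℕ → ℝ) : Prop :=
  ∀ N, F N = ∑ k ∈ range (N + 1), binomRatio N k * a k

/-- The absolute value of `m ^ (-s)`, and `0` at `m = 0`. -/
noncomputable def powWeight (s : ℂ) (m : ℕ) : ℝ :=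
  if m = 0 then 0 else ‖1 / (m : ℂ) ^ s‖

@[simp] theorem powWeight_zero (s : ℂ) : powWeight s 0 = 0 := by simp [powWeight]

theorem powWeight_nonneg (s : ℂ) (m : ℕ) : 0 ≤ powWeight s m := by
  unfold powWeight; split_ifs <;> positivity

theorem powWeight_natCast (k : ℕ) {m : ℕ} (hm : m ≠ 0) :
    powWeight k m = 1 / (m : ℝ) ^ k := by
  simp [powWeight, hm]

theorem powWeight_one {m : ℕ} (hm : m ≠ 0) : powWeight 1 m = 1 / (m : ℝ) := by
  simpa using powWeight_natCast 1 hm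

theorem powWeight_two {m : ℕ} (hm : m ≠ 0) : powWeight 2 m = 1 / (m : ℝ) ^ 2 := by
  simpa using powWeight_natCast 2 hm

/-- Adjoin an outermost exponent `s` to a truncated zeta-star sum. -/
noncomputable def starStep (F : ℕ → ℝ) (s : ℂ) (N : ℕ) : ℝ :=
  ∑ m ∈ range (N + 1), powWeight s m * F m

/-- Adjoin an outermost exponent `s` to a sum over weakly increasing tuples weighted by
`2 ^ (number of distinct values)`, restricted to a fixed largest value. -/
noncomputable def depthStep (a : ℕ → ℝ) (s : ℂ) (m : ℕ) : ℝ :=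
  powWeight s m * (a m + 2 * ∑ j ∈ range m, a j)

@[simp] theorem depthStep_zero (a : ℕ → ℝ) (s : ℂ) : depthStep a s 0 = 0 := by
  simp [depthStep]

/-- Both sides vanish at N = 0, so only increments in N need to agree; `binomRatio_sub_pred` turns
that into `h`. -/
theorem isBinomTransform_starStep {F b : ℕ → ℝ} (s : ℂ) (hb : b 0 = 0)
    (h : ∀ N : ℕ, ∑ k ∈ range (N + 2), binomRatio (N + 1) k * ((k : ℝ) ^ 2 * b k) =
      ((N : ℝ) + 1) ^ 2 * (powWeight s (N + 1) * F (N + 1))) :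
    IsBinomTransform (starStep F s) b := by
  intro N
  induction N with
  | zero => simp [starStep, hb]
  | succ N ih =>
    have hN : ((N : ℝ) + 1) ≠ 0 := by positivity
    -- The extra term k = N + 1 is zero, so both sums can share one range.
    have h1 : ∑ k ∈ range (N + 2), binomRatio N k * b k
        = ∑ k ∈ range (N + 1), binomRatio N k * b k := by
      rw [sum_range_succ _ (N + 1), binomRatio_eq_zero_of_lt (Nat.lt_succ_self N)]; simp
    have h2 : ∑ k ∈ range (N + 2), binomRatio (N + 1) k * b k
        - ∑ k ∈ range (N + 2), binomRatio N k * b k = powWeight s (N + 1) * F (N + 1) := by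
      have := h N
      rw [← sum_sub_distrib]
      apply mul_left_cancel₀ (pow_ne_zero 2 hN)
      rw [← this, mul_sum]
      refine sum_congr rfl fun k _ => ?_
      rw [← sub_mul, binomRatio_sub_pred]; field_simp
    have h3 : starStep F s (N + 1) = starStep F s N + powWeight s (N + 1) * F (N + 1) := by
      simp [starStep, sum_range_succ _ (N + 1)]
    rw [h3, ih, ← h1, ← h2]; ring

theorem IsBinomTransform.starStep_two {F a : ℕ → ℝ} (h : IsBinomTransform F a) (ha : a 0 = 0) :
    IsBinomTransform (starStep F 2) (fun m => powWeight 2 m * a m) := by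
  refine isBinomTransform_starStep 2 (by simp) fun N => ?_
  rw [h (N + 1), powWeight_two (Nat.succ_ne_zero N)]
  push_cast
  have hN : ((N : ℝ) + 1) ≠ 0 := by positivity
  rw [← mul_assoc, mul_one_div_cancel (pow_ne_zero 2 hN), one_mul]
  refine sum_congr rfl fun k _ => ?_
  rcases eq_or_ne k 0 with rfl | hk
  · simp [ha]
  · have : (k : ℝ) ≠ 0 := by exact_mod_cast hk
    rw [powWeight_two hk]; field_simp

/-- Abel summation driven by `binomRatio_succ_mul`; the boundary term vanishes at K = n. -/
theorem sum_binomRatio_telescope (a : ℕ → ℝ) (n K : ℕ) :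
    ∑ k ∈ range (K + 1), binomRatio n k * (k * (a k + 2 * ∑ j ∈ range k, a j)) =
      n * ∑ k ∈ range (K + 1), binomRatio n k * a k
        - (n - K) * binomRatio n K * ∑ j ∈ range (K + 1), a j := by
  induction K with
  | zero => simp [binomRatio]
  | succ K ih =>
    rw [sum_range_succ _ (K + 1), ih, sum_range_succ (fun k => binomRatio n k * a k) (K + 1),
      sum_range_succ a (K + 1)]
    have := binomRatio_succ_mul n K
    push_cast
    linear_combination (∑ j ∈ range (K + 1), a j) * this

theorem IsBinomTransform.starStep_one {F a : ℕ → ℝ} (h : IsBinomTransform F a) :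
    IsBinomTransform (starStep F 1) (depthStep a 1) := by
  refine isBinomTransform_starStep 1 (by simp) fun N => ?_
  have ht := sum_binomRatio_telescope a (N + 1) (N + 1)
  rw [h (N + 1), powWeight_one (Nat.succ_ne_zero N)]
  push_cast at ht ⊢
  rw [sub_self, zero_mul, zero_mul, sub_zero] at ht
  have hN : ((N : ℝ) + 1) ≠ 0 := by positivity
  calc _ = ∑ k ∈ range (N + 2), binomRatio (N + 1) k * (k * (a k + 2 * ∑ j ∈ range k, a j)) := by
        refine sum_congr rfl fun k _ => ?_
        rcases eq_or_ne k 0 with rfl | hk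
        · simp
        · have : (k : ℝ) ≠ 0 := by exact_mod_cast hk
          rw [depthStep, powWeight_one hk]; field_simp
    _ = _ := by rw [ht]; field_simp

theorem powWeight_two_mul_depthStep (a : ℕ → ℝ) (k : ℕ) :
    (fun m => powWeight 2 m * depthStep a (k : ℂ) m) = depthStep a ((k + 2 : ℕ) : ℂ) := by
  funext m
  rcases eq_or_ne m 0 with rfl | hm
  · simp
  · rw [depthStep, depthStep, powWeight_two hm, powWeight_natCast _ hm, powWeight_natCast _ hm,
      pow_add]
    have : (m : ℝ) ≠ 0 := by exact_mod_cast hm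
    field_simp

theorem IsBinomTransform.foldl_block {F a : ℕ → ℝ} (h : IsBinomTransform F a) (q : ℕ) :
    IsBinomTransform (List.foldl starStep F (1 :: List.replicate q 2))
      (depthStep a ((2 * q + 1 : ℕ) : ℂ)) := by
  induction q with
  | zero => simpa using h.starStep_one
  | succ q ih =>
    rw [List.replicate_succ', ← List.cons_append, List.foldl_append]
    have := ih.starStep_two (depthStep_zero _ _)
    rwa [powWeight_two_mul_depthStep] at this

theorem IsBinomTransform.foldl_muIndex {F a : ℕ → ℝ} (h : IsBinomTransform F a) {k : ℕ}
    (hk : Odd k) : IsBinomTransform (List.foldl starStep F (muIndex k)) (depthStep a (k : ℂ)) := by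
  obtain ⟨q, rfl⟩ := hk
  have : (2 * q + 1 - 1) / 2 = q := by omega
  simpa only [muIndex, this] using h.foldl_block q

theorem isBinomTransform_one :
    IsBinomTransform (fun _ => 1) (fun m => if m = 0 then 1 else 0) := by
  intro N
  simp [binomRatio]

theorem isBinomTransform_muConcat {r : ℕ} (k : Fin r → ℕ) (hodd : ∀ i, Odd (k i)) :
    IsBinomTransform (List.foldl starStep (fun _ => 1) (muConcat k))
      (List.foldl depthStep (fun m => if m = 0 then 1 else 0)
        (List.ofFn fun i => (k i : ℂ))) := by
  induction r with
  | zero => simpa [muConcat] using isBinomTransform_one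
  | succ r ih =>
    have h := (ih (fun i => k i.castSucc) fun i => hodd _).foldl_muIndex (hodd (Fin.last r))
    rw [← List.foldl_append] at h
    rw [muConcat, List.ofFn_succ', List.ofFn_succ']
    simpa [muConcat, -List.ofFn_succ] using h

/-! ### Removing the truncation -/

theorem sum_powWeight_two_mul_binomRatio {k : ℕ} (hk : k ≠ 0) (N : ℕ) :
    ∑ m ∈ range (N + 1), powWeight 2 m * binomRatio m k = powWeight 2 k * binomRatio N k := by
  induction N with
  | zero => simp [binomRatio_eq_zero_of_lt (Nat.pos_of_ne_zero hk)]
  | succ N ih =>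
    have := binomRatio_pred_mul_sq N k
    rw [sum_range_succ, ih, powWeight_two hk, powWeight_two (Nat.succ_ne_zero N)]
    have hk' : (k : ℝ) ≠ 0 := by exact_mod_cast hk
    have hN : ((N : ℝ) + 1) ≠ 0 := by positivity
    push_cast
    field_simp
    linear_combination this

theorem tsum_powWeight_two_mul_binomRatio {k : ℕ} (hk : k ≠ 0) :
    ∑' m, ENNReal.ofReal (powWeight 2 m * binomRatio m k) = ENNReal.ofReal (powWeight 2 k) := by
  have h1 := (ENNReal.tendsto_nat_tsum
    fun m => ENNReal.ofReal (powWeight 2 m * binomRatio m k)).comp (tendsto_add_atTop_nat 1)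
  refine tendsto_nhds_unique h1 ?_
  have h2 := ENNReal.tendsto_ofReal ((tendsto_binomRatio k).const_mul (powWeight 2 k))
  rw [mul_one] at h2
  refine h2.congr fun N => ?_
  rw [← sum_powWeight_two_mul_binomRatio hk, ENNReal.ofReal_sum_of_nonneg]
  · rfl
  · exact fun m _ => mul_nonneg (powWeight_nonneg _ _) (binomRatio_nonneg _ _)

/-- Expand F and exchange the sums by Tonelli; no convergence is assumed. -/
theorem IsBinomTransform.tsum_powWeight_two_mul {F a : ℕ → ℝ} (h : IsBinomTransform F a)
    (ha : a 0 = 0) (hpos : ∀ k, 0 ≤ a k) :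
    ∑' m, ENNReal.ofReal (powWeight 2 m * F m) =
      ∑' k, ENNReal.ofReal (powWeight 2 k * a k) := by
  have h1 : ∀ m, ENNReal.ofReal (powWeight 2 m * F m) =
      ∑' k, ENNReal.ofReal (powWeight 2 m * binomRatio m k) * ENNReal.ofReal (a k) := by
    intro m
    rw [tsum_eq_sum (s := range (m + 1)), h m, mul_sum, ENNReal.ofReal_sum_of_nonneg]
    · refine sum_congr rfl fun k _ => ?_
      rw [← ENNReal.ofReal_mul (mul_nonneg (powWeight_nonneg _ _) (binomRatio_nonneg _ _)),
        mul_assoc]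
    · exact fun k _ => mul_nonneg (powWeight_nonneg _ _)
        (mul_nonneg (binomRatio_nonneg _ _) (hpos k))
    · intro k hk
      rw [binomRatio_eq_zero_of_lt (by simpa using hk)]; simp
  simp_rw [h1]
  rw [ENNReal.tsum_comm]
  refine tsum_congr fun k => ?_
  rw [ENNReal.tsum_mul_right]
  rcases eq_or_ne k 0 with rfl | hk
  · simp [ha]
  · rw [tsum_powWeight_two_mul_binomRatio hk, ENNReal.ofReal_mul (powWeight_nonneg _ _)]

/-! ### Sums over chains -/

open Classical in
/-- The weighted sum over the words of length `n` whose letters satisfy `P` and are pairwise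
related by `R`. -/
noncomputable def chainSum {X : Type*} (R : X → X → Prop) (n : ℕ) (w : Fin n → X → ENNReal)
    (P : X → Prop) : ENNReal :=
  ∑' t : Fin n → X,
    if (∀ i j, i < j → R (t i) (t j)) ∧ ∀ i, P (t i) then ∏ i, w i (t i) else 0

theorem chainSum_zero {X : Type*} (R : X → X → Prop) (w : Fin 0 → X → ENNReal) (P : X → Prop) :
    chainSum R 0 w P = 1 := by
  simp [chainSum]

open Classical in
-- Condition on the last letter y: by `hP`, once P holds at y it holds at every letter related to y.
theorem chainSum_succ {X : Type*} {R : X → X → Prop} {n : ℕ} (w : Fin (n + 1) → X → ENNReal)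
    {P : X → Prop} (hP : ∀ x y, R x y → P y → P x) :
    chainSum R (n + 1) w P = ∑' y, if P y then
      w (Fin.last n) y * chainSum R n (fun i => w i.castSucc) (fun x => R x y) else 0 := by
  unfold chainSum
  rw [← (Fin.snocEquiv fun _ => X).tsum_eq, ENNReal.tsum_prod']
  refine tsum_congr fun y => ?_
  split_ifs with hy
  · rw [← ENNReal.tsum_mul_left]
    refine tsum_congr fun t => ?_
    have : ((∀ i j, i < j → R (Fin.snocEquiv (fun _ => X) (y, t) i)
        (Fin.snocEquiv (fun _ => X) (y, t) j)) ∧ ∀ i, P (Fin.snocEquiv (fun _ => X) (y, t) i)) ↔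
        ((∀ i j, i < j → R (t i) (t j)) ∧ ∀ i, R (t i) y) := by
      simp only [Fin.forall_fin_succ', Fin.snocEquiv_apply, Fin.snoc_castSucc, Fin.snoc_last,
        Fin.castSucc_lt_castSucc_iff, Fin.castSucc_lt_last, true_imp_iff, lt_irrefl,
        false_imp_iff, and_true, Fin.not_lt.2 (Fin.le_last _), hy]
      constructor
      · rintro ⟨⟨h, -⟩, -⟩
        exact ⟨fun i => (h i).1, fun i => (h i).2⟩
      · rintro ⟨h1, h2⟩
        exact ⟨⟨fun i => ⟨h1 i, h2 i⟩, fun _ => trivial⟩, fun i => hP _ _ (h2 i) hy⟩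
    rw [if_congr this rfl rfl]
    split_ifs
    · rw [Fin.prod_univ_castSucc]
      simp [Fin.snocEquiv_apply, mul_comm]
    · simp
  · refine ENNReal.tsum_eq_zero.2 fun t => if_neg fun h => hy ?_
    simpa using h.2 (Fin.last n)

theorem tsum_pnat_eq_tsum_nat {f : ℕ → ENNReal} (hf : f 0 = 0) :
    ∑' m : ℕ+, f m = ∑' m, f m := by
  rw [tsum_pnat_eq_tsum_succ (f := f), tsum_eq_zero_add' (f := f) ENNReal.summable, hf, zero_add]

theorem tsum_ite_ofReal_eq_sum {g : ℕ → ℝ} (hg : ∀ m, 0 ≤ g m) {p : ℕ → Prop} [DecidablePred p]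
    {N : ℕ} (hp : ∀ m, p m ↔ m < N) :
    (∑' m, if p m then ENNReal.ofReal (g m) else 0) = ENNReal.ofReal (∑ m ∈ range N, g m) := by
  rw [tsum_eq_sum (s := range N), ENNReal.ofReal_sum_of_nonneg fun m _ => hg m]
  · exact sum_congr rfl fun m hm => if_pos ((hp m).2 (mem_range.1 hm))
  · exact fun m hm => if_neg fun h => hm (mem_range.2 ((hp m).1 h))

theorem starStep_nonneg {F : ℕ → ℝ} (hF : ∀ m, 0 ≤ F m) (s : ℂ) (N : ℕ) : 0 ≤ starStep F s N :=
  sum_nonneg fun m _ => mul_nonneg (powWeight_nonneg s m) (hF m)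

theorem depthStep_nonneg {a : ℕ → ℝ} (ha : ∀ m, 0 ≤ a m) (s : ℂ) (m : ℕ) :
    0 ≤ depthStep a s m :=
  mul_nonneg (powWeight_nonneg s m)
    (add_nonneg (ha m) (mul_nonneg zero_le_two (sum_nonneg fun j _ => ha j)))

/-- The zeta-star sum with exponents `l`, truncated at the argument. -/
noncomputable def starTrunc (l : List ℂ) : ℕ → ℝ := l.foldl starStep fun _ => 1

/-- The `m`-th value is the sum over weakly increasing tuples with largest entry `m` and
exponents `l`, weighted by `2 ^ (number of distinct values)`. -/
noncomputable def depthCoeff (l : List ℂ) : ℕ → ℝ :=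
  l.foldl depthStep fun m => if m = 0 then 1 else 0

theorem starTrunc_append (l : List ℂ) (s : ℂ) :
    starTrunc (l ++ [s]) = starStep (starTrunc l) s := by simp [starTrunc]

theorem depthCoeff_append (l : List ℂ) (s : ℂ) :
    depthCoeff (l ++ [s]) = depthStep (depthCoeff l) s := by simp [depthCoeff]

theorem starTrunc_nonneg (l : List ℂ) (N : ℕ) : 0 ≤ starTrunc l N := by
  induction l using List.reverseRecOn generalizing N with
  | nil => simp [starTrunc]
  | append_singleton l s ih => rw [starTrunc_append]; exact starStep_nonneg ih s N

theorem depthCoeff_nonneg (l : List ℂ) (m : ℕ) : 0 ≤ depthCoeff l m := by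
  induction l using List.reverseRecOn generalizing m with
  | nil => simp only [depthCoeff, List.foldl_nil]; split_ifs <;> norm_num
  | append_singleton l s ih => rw [depthCoeff_append]; exact depthStep_nonneg ih s m

/-- The weights of the words of a zeta-star series. -/
noncomputable def starWeight {n : ℕ} (e : Fin n → ℂ) (i : Fin n) (m : ℕ+) : ENNReal :=
  ENNReal.ofReal (powWeight (e i) m)

theorem chainSum_starWeight {n : ℕ} (e : Fin n → ℂ) (x : ℕ+) :
    chainSum (· ≤ ·) n (starWeight e) (· ≤ x) =
      ENNReal.ofReal (starTrunc (List.ofFn e) x) := by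
  classical
  induction n generalizing x with
  | zero => simp [chainSum_zero, starTrunc]
  | succ n ih =>
    rw [chainSum_succ _ fun _ _ h1 h2 => le_trans h1 h2, List.ofFn_succ', List.concat_eq_append,
      starTrunc_append, starStep]
    rw [← tsum_ite_ofReal_eq_sum (p := fun m => m ≤ (x : ℕ))
      (fun m => mul_nonneg (powWeight_nonneg _ _) (starTrunc_nonneg _ _))
      (fun m => Nat.lt_succ_iff.symm), ← tsum_pnat_eq_tsum_nat (by simp)]
    refine tsum_congr fun y => ?_
    by_cases hy : y ≤ x
    · rw [if_pos hy, if_pos (PNat.coe_le_coe _ _ |>.2 hy), ENNReal.ofReal_mul (powWeight_nonneg _ _),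
        ← ih]
      rfl
    · rw [if_neg hy, if_neg fun h => hy (PNat.coe_le_coe _ _ |>.1 h)]

theorem chainSum_starWeight_true {n : ℕ} (e : Fin n → ℂ) {l : List ℂ} {s : ℂ}
    (h : List.ofFn e = l ++ [s]) :
    chainSum (· ≤ ·) n (starWeight e) (fun _ => True) =
      ∑' m, ENNReal.ofReal (powWeight s m * starTrunc l m) := by
  cases n with
  | zero => simp at h
  | succ n =>
    rw [List.ofFn_succ', List.concat_eq_append] at h
    obtain ⟨rfl, h⟩ := List.append_inj' h rfl
    obtain rfl : e (Fin.last n) = s := by simpa using h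
    rw [chainSum_succ _ (by simp), ← tsum_pnat_eq_tsum_nat (by simp)]
    refine tsum_congr fun y => ?_
    rw [if_pos trivial, ENNReal.ofReal_mul (powWeight_nonneg _ _), ← chainSum_starWeight]
    rfl

/-- The relation between the letters of a row from left to right. -/
def RowLT (x y : MarkedLetter) : Prop :=
  x ≤ y ∧ ∀ i, ¬ (x = MarkedLetter.marked i ∧ y = MarkedLetter.marked i)

theorem rowLT_iff_of_marked (x : MarkedLetter) (m : ℕ+) :
    RowLT x (MarkedLetter.marked m) ↔ x.abs < m := by
  obtain ⟨⟨j, b⟩, rfl⟩ := toLex.surjective x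
  cases b <;>
    simp [RowLT, MarkedLetter.marked, MarkedLetter.abs, Prod.Lex.toLex_le_toLex]
  grind

theorem rowLT_iff_of_unmarked (x : MarkedLetter) (m : ℕ+) :
    RowLT x (MarkedLetter.unmarked m) ↔ x.abs ≤ m := by
  obtain ⟨⟨j, b⟩, rfl⟩ := toLex.surjective x
  cases b <;>
    simp [RowLT, MarkedLetter.marked, MarkedLetter.unmarked, MarkedLetter.abs,
      Prod.Lex.toLex_le_toLex]
  all_goals exact le_iff_lt_or_eq.symm

theorem abs_le_abs_of_rowLT {x y : MarkedLetter} (h : RowLT x y) : x.abs ≤ y.abs := by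
  obtain ⟨⟨m, b⟩, rfl⟩ := toLex.surjective y
  cases b
  · exact ((rowLT_iff_of_marked x m).1 h).le
  · exact (rowLT_iff_of_unmarked x m).1 h

theorem RowLT.trans {x y z : MarkedLetter} (h1 : RowLT x y) (h2 : RowLT y z) : RowLT x z := by
  have h := abs_le_abs_of_rowLT h1
  obtain ⟨⟨m, b⟩, rfl⟩ := toLex.surjective z
  cases b
  · exact (rowLT_iff_of_marked x m).2 (h.trans_lt ((rowLT_iff_of_marked y m).1 h2))
  · exact (rowLT_iff_of_unmarked x m).2 (h.trans ((rowLT_iff_of_unmarked y m).1 h2))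

theorem tsum_markedLetter (f : MarkedLetter → ENNReal) :
    ∑' x, f x = ∑' m : ℕ+, (f (MarkedLetter.marked m) + f (MarkedLetter.unmarked m)) := by
  rw [← (toLex (α := ℕ+ × Bool)).tsum_eq, ENNReal.tsum_prod']
  refine tsum_congr fun m => ?_
  rw [tsum_bool]
  rfl

/-- The weights of the words of a Schur Q-multiple zeta series with one row. -/
noncomputable def rowWeight {n : ℕ} (e : Fin n → ℂ) (i : Fin n) (x : MarkedLetter) : ENNReal :=
  ENNReal.ofReal (powWeight (e i) x.abs)

theorem rowWeight_mul_add (l : List ℂ) (s : ℂ) (m : ℕ) :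
    ENNReal.ofReal (powWeight s m) * ENNReal.ofReal (∑ j ∈ range m, depthCoeff l j) +
      ENNReal.ofReal (powWeight s m) * ENNReal.ofReal (∑ j ∈ range (m + 1), depthCoeff l j) =
    ENNReal.ofReal (depthCoeff (l ++ [s]) m) := by
  have h : ∀ N, 0 ≤ ∑ j ∈ range N, depthCoeff l j :=
    fun N => sum_nonneg fun j _ => depthCoeff_nonneg l j
  rw [← mul_add, ← ENNReal.ofReal_add (h _) (h _), ← ENNReal.ofReal_mul (powWeight_nonneg _ _),
    depthCoeff_append, depthStep, sum_range_succ]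
  congr 1; ring

/-- A condition depending only on |x| treats the last letters m' and m alike, so their contributions
merge into one coefficient. -/
theorem chainSum_rowWeight_aux {n : ℕ} (e : Fin (n + 1) → ℂ)
    (ih : ∀ x : ℕ+,
      chainSum RowLT n (rowWeight fun i => e i.castSucc) (RowLT · (.marked x)) =
        ENNReal.ofReal (∑ j ∈ range x, depthCoeff (List.ofFn fun i => e i.castSucc) j) ∧
      chainSum RowLT n (rowWeight fun i => e i.castSucc) (RowLT · (.unmarked x)) =
        ENNReal.ofReal (∑ j ∈ range (x + 1), depthCoeff (List.ofFn fun i => e i.castSucc) j))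
    (P : MarkedLetter → Prop) (hP : ∀ x y, RowLT x y → P y → P x)
    (p : ℕ → Prop) [DecidablePred p] (hp : ∀ x : MarkedLetter, P x ↔ p x.abs) :
    chainSum RowLT (n + 1) (rowWeight e) P =
      ∑' m, if p m then ENNReal.ofReal (depthCoeff (List.ofFn e) m) else 0 := by
  classical
  rw [List.ofFn_succ', List.concat_eq_append, chainSum_succ _ hP, tsum_markedLetter,
    ← tsum_pnat_eq_tsum_nat (by simp [depthCoeff_append])]
  refine tsum_congr fun m => ?_
  have h1 : P (.marked m) ↔ p m := hp _
  have h2 : P (.unmarked m) ↔ p m := hp _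
  rw [if_congr h1 rfl rfl, if_congr h2 rfl rfl]
  split_ifs
  · rw [← rowWeight_mul_add, ← (ih m).1, ← (ih m).2]
    rfl
  · simp

theorem chainSum_rowWeight {n : ℕ} (e : Fin n → ℂ) (x : ℕ+) :
    chainSum RowLT n (rowWeight e) (RowLT · (.marked x)) =
      ENNReal.ofReal (∑ j ∈ range x, depthCoeff (List.ofFn e) j) ∧
    chainSum RowLT n (rowWeight e) (RowLT · (.unmarked x)) =
      ENNReal.ofReal (∑ j ∈ range (x + 1), depthCoeff (List.ofFn e) j) := by
  induction n generalizing x with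
  | zero => simp [chainSum_zero, depthCoeff]
  | succ n ih =>
    constructor
    · rw [chainSum_rowWeight_aux e (ih _) _ (fun _ _ => RowLT.trans) (fun m => m < (x : ℕ))
        fun y => by rw [rowLT_iff_of_marked, PNat.coe_lt_coe],
        tsum_ite_ofReal_eq_sum (depthCoeff_nonneg _) fun _ => Iff.rfl]
    · rw [chainSum_rowWeight_aux e (ih _) _ (fun _ _ => RowLT.trans) (fun m => m ≤ (x : ℕ))
        fun y => by rw [rowLT_iff_of_unmarked, PNat.coe_le_coe],
        tsum_ite_ofReal_eq_sum (depthCoeff_nonneg _) fun _ => Nat.lt_succ_iff.symm]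

theorem chainSum_rowWeight_true {n : ℕ} (e : Fin (n + 1) → ℂ) :
    chainSum RowLT (n + 1) (rowWeight e) (fun _ => True) =
      ∑' m, ENNReal.ofReal (depthCoeff (List.ofFn e) m) := by
  rw [chainSum_rowWeight_aux e (chainSum_rowWeight _) _ (by simp) (fun _ => True) (by simp)]
  simp

/-! ### Convergence -/

theorem powWeight_le_one_div {k : ℕ} (hk : 1 ≤ k) (m : ℕ) : powWeight k m ≤ 1 / (m : ℝ) := by
  rcases Nat.eq_zero_or_pos m with rfl | hm
  · simp
  · have : (1 : ℝ) ≤ m := by exact_mod_cast hm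
    rw [powWeight_natCast _ hm.ne']
    exact one_div_le_one_div_of_le (by positivity) (le_self_pow₀ this (by omega))

/-- The right side telescopes, bounding ∑ 1/√j by 2√m. -/
theorem one_div_sqrt_succ_le (m : ℕ) :
    1 / √((m : ℝ) + 1) ≤ 2 * (√((m : ℝ) + 1) - √(m : ℝ)) := by
  have hb : 0 < √((m : ℝ) + 1) := Real.sqrt_pos.2 (by positivity)
  have h1 := Real.sq_sqrt (show (0 : ℝ) ≤ (m : ℝ) + 1 by positivity)
  have h2 := Real.sq_sqrt (Nat.cast_nonneg (α := ℝ) m)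
  rw [div_le_iff₀ hb]
  nlinarith [sq_nonneg (√((m : ℝ) + 1) - √(m : ℝ))]

theorem depthStep_le {a : ℕ → ℝ} (ha : ∀ m, 0 ≤ a m) (s : ℂ) (m : ℕ) :
    depthStep a s m ≤ powWeight s m * (2 * ∑ j ∈ range (m + 1), a j) := by
  refine mul_le_mul_of_nonneg_left ?_ (powWeight_nonneg s m)
  rw [sum_range_succ]
  linarith [ha m]

/-- A bound of order √m reproduces itself: one more step makes the coefficients at most 2C/√m, with
partial sums at most 4C√m. -/
theorem sum_depthCoeff_le (l : List ℂ) (hl : ∀ s ∈ l, ∀ m, powWeight s m ≤ 1 / (m : ℝ)) :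
    ∃ C : ℝ, 0 ≤ C ∧ ∀ m ≠ 0, ∑ j ∈ range (m + 1), depthCoeff l j ≤ C * √(m : ℝ) := by
  induction l using List.reverseRecOn with
  | nil =>
    refine ⟨1, zero_le_one, fun m hm => ?_⟩
    simpa [depthCoeff] using Nat.one_le_iff_ne_zero.2 hm
  | append_singleton l s ih =>
    obtain ⟨C, hC, h⟩ := ih fun t ht => hl t (by simp [ht])
    rw [depthCoeff_append]
    suffices H : ∀ m : ℕ, ∑ j ∈ range (m + 1), depthStep (depthCoeff l) s j ≤ 4 * C * √(m : ℝ) from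
      ⟨4 * C, by positivity, fun m _ => H m⟩
    intro m
    induction m with
    | zero => simp
    | succ m ihm =>
      rw [sum_range_succ]
      have hb : 0 < √((m : ℝ) + 1) := Real.sqrt_pos.2 (by positivity)
      have h1 : depthStep (depthCoeff l) s (m + 1) ≤ 2 * C * (1 / √((m : ℝ) + 1)) := by
        calc _ ≤ powWeight s (m + 1) * (2 * ∑ j ∈ range (m + 1 + 1), depthCoeff l j) :=
              depthStep_le (depthCoeff_nonneg l) s _
          _ ≤ 1 / ((m + 1 : ℕ) : ℝ) * (2 * (C * √((m + 1 : ℕ) : ℝ))) := by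
              have := h (m + 1) (Nat.succ_ne_zero m)
              have h2 := hl s (by simp) (m + 1)
              have h3 := sum_nonneg fun j (_ : j ∈ range (m + 1 + 1)) => depthCoeff_nonneg l j
              gcongr
          _ = _ := by
              push_cast
              have := Real.sq_sqrt (show (0 : ℝ) ≤ (m : ℝ) + 1 by positivity)
              field_simp
              rw [this]
              ring
      have h2 := mul_le_mul_of_nonneg_left (one_div_sqrt_succ_le m) hC
      push_cast
      linarith

theorem tsum_depthCoeff_ne_top (l : List ℂ) (hl : ∀ s ∈ l, ∀ m, powWeight s m ≤ 1 / (m : ℝ))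
    {k : ℕ} (hk : 3 ≤ k) :
    ∑' m, ENNReal.ofReal (depthCoeff (l ++ [(k : ℂ)]) m) ≠ ⊤ := by
  obtain ⟨C, hC, h⟩ := sum_depthCoeff_le l hl
  refine Summable.tsum_ofReal_ne_top ?_
  refine Summable.of_nonneg_of_le (depthCoeff_nonneg _) (fun m => ?_)
    ((Real.summable_one_div_nat_pow.2 one_lt_two).mul_left (2 * C))
  rw [depthCoeff_append]
  rcases eq_or_ne m 0 with rfl | hm
  · simp
  -- Even the weaker bound C·m on the partial sums suffices against m⁻³.
  have h1 : (1 : ℝ) ≤ m := by exact_mod_cast Nat.one_le_iff_ne_zero.2 hm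
  have h2 : √(m : ℝ) ≤ m := Real.sqrt_le_self_iff.2 (Or.inr h1)
  calc _ ≤ powWeight k m * (2 * ∑ j ∈ range (m + 1), depthCoeff l j) :=
        depthStep_le (depthCoeff_nonneg l) _ _
    _ ≤ 1 / (m : ℝ) ^ 3 * (2 * (C * m)) := by
        rw [powWeight_natCast _ hm]
        have := (h m hm).trans (mul_le_mul_of_nonneg_left h2 hC)
        gcongr
        exact mul_nonneg zero_le_two (sum_nonneg fun j _ => depthCoeff_nonneg l j)
    _ = _ := by field_simp

/-! ### The two series -/

/-- Carries identities in [0,∞] back to ℂ, the terms being nonnegative reals. -/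
theorem summable_and_tsum_eq_of_nonneg {ι : Type*} {f : ι → ℂ} (hf : ∀ i, f i = (‖f i‖ : ℝ))
    (h : ∑' i, ‖f i‖ₑ ≠ ⊤) :
    Summable f ∧ ∑' i, f i = ((∑' i, ‖f i‖ₑ).toReal : ℂ) := by
  refine ⟨Summable.of_norm (by simpa using ENNReal.summable_toReal h), ?_⟩
  rw [ENNReal.tsum_toReal_eq fun i => by simp, Complex.ofReal_tsum]
  exact tsum_congr fun i => by rw [hf i]; simp

theorem one_div_prod_cpow_eq_norm {ι : Type*} [Fintype ι] (m : ι → ℕ) (s : ι → ℂ)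
    (hs : ∀ i, ∃ n : ℕ, s i = n) :
    1 / ∏ i, (m i : ℂ) ^ s i = (‖1 / ∏ i, (m i : ℂ) ^ s i‖ : ℝ) := by
  choose n hn using hs
  simp [hn]

theorem enorm_one_div_prod_cpow {ι : Type*} [Fintype ι] (m : ι → ℕ+) (s : ι → ℂ) :
    ‖1 / ∏ i, ((m i : ℕ) : ℂ) ^ s i‖ₑ = ∏ i, ENNReal.ofReal (powWeight (s i) (m i)) := by
  rw [← ENNReal.ofReal_prod_of_nonneg fun i _ => powWeight_nonneg _ _, ← ofReal_norm]
  simp [powWeight]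

theorem tsum_subtype_eq_tsum_ite {X : Type*} {p q : X → Prop} {_ : DecidablePred q}
    (h : ∀ x, p x ↔ q x) (f : X → ENNReal) :
    ∑' x : {x // p x}, f x = ∑' x, if q x then f x else 0 := by
  refine (tsum_subtype {x | p x} f).trans (tsum_congr fun x => ?_)
  simp [Set.indicator_apply, h]

theorem tsum_enorm_zetaStarTerm (s : List ℂ) :
    ∑' m, ‖zetaStarTerm s m‖ₑ = chainSum (· ≤ ·) s.length (starWeight s.get) fun _ => True := by
  unfold chainSum zetaStarTerm
  simp_rw [enorm_one_div_prod_cpow]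
  refine tsum_subtype_eq_tsum_ite (fun t => ?_)
    fun t : Fin s.length → ℕ+ => ∏ i, starWeight s.get i (t i)
  rw [monotone_iff_forall_lt]
  simp

/-- The boxes of a one-row diagram. -/
def oneRowBoxEquiv (r : ℕ) : (oneRow r).Box ≃ Fin r where
  toFun b := b.2
  invFun j := ⟨(0 : Fin 1), j⟩
  left_inv b := by
    obtain ⟨i, j⟩ := b
    obtain rfl : i = (0 : Fin 1) := Subsingleton.elim (α := Fin 1) _ _
    rfl
  right_inv _ := rfl

/-- Tableaux of one row are words. -/
def oneRowEquiv (r : ℕ) (X : Type*) : (Fin r → X) ≃ ShiftedTableau (oneRow r) X :=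
  Equiv.arrowCongr (oneRowBoxEquiv r).symm (Equiv.refl X)

theorem oneRow_row_eq {r : ℕ} (b : (oneRow r).Box) : b.row = 1 := by
  have : (b.1 : ℕ) < 1 := b.1.isLt
  simp only [StrictPartition.Box.row]
  omega

theorem oneRow_col_eq {r : ℕ} (b : (oneRow r).Box) : b.col = 1 + (oneRowBoxEquiv r b : ℕ) :=
  congrArg (· + (b.2 : ℕ)) (oneRow_row_eq b)

theorem isQSST_oneRow_iff {r : ℕ} (t : Fin r → MarkedLetter) :
    IsQSST (oneRowEquiv r MarkedLetter t) ↔ ∀ i j, i < j → RowLT (t i) (t j) := by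
  constructor
  · intro h i j hij
    refine ⟨h.row_weak ((oneRowBoxEquiv r).symm i) ((oneRowBoxEquiv r).symm j) rfl ?_,
      fun m hm => hij.ne ?_⟩
    · simpa [oneRow_col_eq] using hij.le
    · exact (oneRowBoxEquiv r).symm.injective (h.marked_row m _ _ rfl hm.1 hm.2)
  · intro h
    have hcol : ∀ b c : (oneRow r).Box, b.col = c.col → b = c := fun b c hbc =>
      (oneRowBoxEquiv r).injective (Fin.ext (by simpa [oneRow_col_eq] using hbc))
    refine ⟨fun b c _ hbc => ?_, fun b c hbc _ => by rw [hcol b c hbc], fun m b c _ hb hc => ?_,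
      fun m b c hbc _ _ => hcol b c hbc⟩
    · rcases hbc.lt_or_eq with hbc | hbc
      · exact (h (oneRowBoxEquiv r b) (oneRowBoxEquiv r c)
          (by simpa [oneRow_col_eq] using hbc)).1
      · rw [hcol b c hbc]
    · rcases lt_trichotomy (oneRowBoxEquiv r b) (oneRowBoxEquiv r c) with hlt | heq | hlt
      · exact absurd ⟨hb, hc⟩ ((h _ _ hlt).2 m)
      · exact (oneRowBoxEquiv r).injective heq
      · exact absurd ⟨hc, hb⟩ ((h _ _ hlt).2 m)

theorem tsum_enorm_schurQTerm_oneRow {r : ℕ} (e : Fin r → ℂ) :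
    ∑' M, ‖schurQTerm (oneRowTableau e) M‖ₑ =
      chainSum RowLT r (rowWeight e) fun _ => True := by
  have h := ((oneRowEquiv r MarkedLetter).subtypeEquiv fun t => (isQSST_oneRow_iff t).symm).tsum_eq
    fun M : QSST (oneRow r) => ‖schurQTerm (oneRowTableau e) M‖ₑ
  rw [← h]
  unfold chainSum schurQTerm
  simp_rw [enorm_one_div_prod_cpow]
  have h2 : ∀ t : Fin r → MarkedLetter,
      ∏ b : (oneRow r).Box, ENNReal.ofReal (powWeight (oneRowTableau e b)
        (MarkedLetter.abs (oneRowEquiv r MarkedLetter t b))) = ∏ i, rowWeight e i (t i) := by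
    intro t
    exact Fintype.prod_equiv (oneRowBoxEquiv r) _ _ fun b => rfl
  simp only [Equiv.subtypeEquiv_apply, h2]
  exact tsum_subtype_eq_tsum_ite (fun t => by simp)
    fun t : Fin r → MarkedLetter => ∏ i, rowWeight e i (t i)

theorem mainTheorem5 (r : ℕ) (hr : 0 < r) (k : Fin r → ℕ) (hodd : ∀ i, Odd (k i))
    (hlast : 3 ≤ k ⟨r - 1, Nat.sub_lt hr Nat.one_pos⟩) :
    Summable (schurQTerm (oneRowTableau fun i => (k i : ℂ))) ∧
    Summable (zetaStarTerm (muConcat k)) ∧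
    schurQZeta (oneRow r) (oneRowTableau fun i => (k i : ℂ)) = zetaStar (muConcat k) := by
  obtain ⟨r, rfl⟩ : ∃ r', r = r' + 1 := ⟨r - 1, by omega⟩
  replace hlast : 3 ≤ k (Fin.last r) := hlast
  have hQ : ∑' M, ‖schurQTerm (oneRowTableau fun i => (k i : ℂ)) M‖ₑ =
      ∑' m, ENNReal.ofReal (depthCoeff (List.ofFn fun i => (k i : ℂ)) m) := by
    rw [tsum_enorm_schurQTerm_oneRow, chainSum_rowWeight_true]
  have hfin : ∑' m, ENNReal.ofReal (depthCoeff (List.ofFn fun i => (k i : ℂ)) m) ≠ ⊤ := by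
    rw [List.ofFn_succ', List.concat_eq_append]
    refine tsum_depthCoeff_ne_top _ (fun s hs => ?_) hlast
    obtain ⟨i, rfl⟩ := (List.mem_ofFn' _ _).1 hs
    exact powWeight_le_one_div (hodd _).pos
  have hS : ∑' m, ‖zetaStarTerm (muConcat k) m‖ₑ =
      ∑' m, ENNReal.ofReal (depthCoeff (List.ofFn fun i => (k i : ℂ)) m) := by
    obtain ⟨q, hq⟩ : ∃ q, k (Fin.last r) = 2 * q + 1 + 2 := by
      obtain ⟨p, hp⟩ := hodd (Fin.last r)
      exact ⟨p - 1, by omega⟩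
    -- The final 2 is split off: it supplies the weight for the limit formula, and the remaining
    -- index is handled by the finite transform.
    have hmu : muConcat k = (muConcat (fun i => k (Fin.castSucc i)) ++
        1 :: List.replicate q 2) ++ [2] := by
      rw [muConcat, List.ofFn_succ', List.concat_eq_append, List.flatten_append, hq]
      simp [muIndex, List.replicate_succ', muConcat]
    have hT := (isBinomTransform_muConcat (fun i => k (Fin.castSucc i))
      fun i => hodd _).foldl_block q
    rw [← List.foldl_append] at hT
    rw [tsum_enorm_zetaStarTerm, chainSum_starWeight_true _ ((List.ofFn_get _).trans hmu),
      List.ofFn_succ', List.concat_eq_append, depthCoeff_append]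
    refine (hT.tsum_powWeight_two_mul (depthStep_zero _ _)
      (depthStep_nonneg (depthCoeff_nonneg _) _)).trans (tsum_congr fun m => ?_)
    rw [hq]
    exact congrArg ENNReal.ofReal (congrFun (powWeight_two_mul_depthStep _ (2 * q + 1)) m)
  have hnat : ∀ i, ∃ n : ℕ, (muConcat k).get i = n := by
    intro i
    have h := (muConcat k).get_mem i
    generalize (muConcat k).get i = s at h ⊢
    simp only [muConcat, muIndex, List.mem_flatten, List.mem_ofFn', Set.mem_range] at h
    obtain ⟨_, ⟨j, rfl⟩, h⟩ := h
    rcases List.mem_cons.1 h with rfl | h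
    · exact ⟨1, by simp⟩
    · exact ⟨2, by simpa using List.eq_of_mem_replicate h⟩
  have h1 := summable_and_tsum_eq_of_nonneg
    (f := schurQTerm (oneRowTableau fun i => (k i : ℂ)))
    (fun M => one_div_prod_cpow_eq_norm _ _ fun b => ⟨k b.2, rfl⟩) (hQ.trans_ne hfin)
  have h2 := summable_and_tsum_eq_of_nonneg (f := zetaStarTerm (muConcat k))
    (fun M => one_div_prod_cpow_eq_norm _ _ hnat) (hS.trans_ne hfin)
  refine ⟨h1.1, h2.1, ?_⟩
  rw [schurQZeta, zetaStar, h1.2, h2.2, hQ, hS]
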